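/- Let $p$ be an odd prime and let $R_p$ be the dihedral quandle $\mathbb{Z}/p\mathbb{Z}$ with operation $x\ast y=2y-x$. Let $\theta_p:R_p^3\to\mathbb{Z}/p\mathbb{Z}$ be Mochizuki's $3$-cocycle $$\theta_p(x,y,z)=(x-y)\,\frac{y^p+(2z-y)^p-2z^p}{p},$$ where the fraction is computed with integers representing $y,z$ and then reduced modulo $p$. For an oriented link diagram $D$ in the plane, a shadow $R_p$-coloring is a map $c$ from the arcs of $D$ and the regions of the complement of the underlying curves to $R_p$ such that (normal vectors of arcs point to the left) at each crossing $c(\alpha)\ast c(\beta)=c(\gamma)$, where $\beta$ is the over arc and $\alpha,\gamma$ are the under arcs to the right and to the left of $\beta$, and such that along each arc $\alpha$ with region $r_1$ to its right and $r_2$ to its left $c(r_1)\ast c(\alpha)=c(r_2)$. Let $\mathrm{SCol}(D)$ be the finite set of shadow $R_p$-colorings of $D$, and for $a\in R_p$ let $\mathrm{SCol}(D,a)$ be the set of those for which the unbounded region has color $a$. The weight $\Phi_{\theta_p}(D,c)$ is the sum over all crossings of $\pm\theta_p(x,y,z)$, where $\pm$ is the sign of the crossing, $z$ is the color of the over arc,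 $y$ is the color of the under arc to its right, and $x$ is the color of the region to the right of both strands. The shadow cocycle invariant $\Phi_{\theta_p}(D)$ is the multiset of all $\Phi_{\theta_p}(D,c)$, $c\in\mathrm{SCol}(D)$. For a set $S\subset\mathrm{End}(R_p)$ of quandle endomorphisms, the shadow quandle cocycle quiver $SQ^{S,\theta_p}_{R_p}(D,a)$ has vertex set $\mathrm{SCol}(D,a)$, an edge from $v$ to $w$ whenever $w=f\circ v$ on the arcs of $D$ for some $f\in S$, and the label $\Phi_{\theta_p}(D,c)$ on each vertex $c$. Two such labelled quivers are isomorphic if there is a bijection between their vertices which is an isomorphism of quivers and preserves labels. Theorem. Let $D$ and $D'$ be oriented link diagrams. For any $a\in R_p$ and any $S\subset\mathrm{End}(R_p)$, the shadow quandle cocycle quivers $SQ^{S,\theta_p}_{R_p}(D,a)$ and $SQ^{S,\theta_p}_{R_p}(D',a)$ are isomorphic if and only if $\Phi_{\theta_p}(D)=\Phi_{\theta_p}(D')$ as multisets. The same equivalence holds if the quivers are taken with multiple edges, that is, with one edge from $v$ to $w$ for every $f\in S$ with $w=f\circ v$ on the arcs. -/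

import Mathlib

universe u v

open scoped Quandles

/-! ## Oriented link diagrams

Oriented link diagrams in the plane, up to orientation preserving homeomorphism, in the
combinatorial form of planar 4-valent maps with crossing information. -/

/-- The two strands through a crossing. -/
inductive Strand : Type
  | over
  | under

/-- Draw a crossing with sign `ε` so that both strands are oriented upwards. Then this is the strand
which runs from the lower left to the upper right: the over strand if the crossing is positive,
the under strand if it is negative. -/
def Strand.rising (ε : ℤˣ) : Strand := if ε = 1 then Strand.over else Strand.under

/-- The strand which runs from the lower right to the upper left. -/
def Strand.falling (ε : ℤˣ) : Strand := if ε = 1 then Strand.under else Strand.over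

/-- An oriented link diagram on the plane.

* Cutting the underlying immersed circles at the crossings gives the oriented edges. Each of the two
  strands of a crossing has an edge that arrives there and an edge that departs there
  (possibly the same one); every edge arrives at most once, departs at most once, and arrives
  somewhere if and only if it departs from somewhere. The remaining edges are the components of
  the diagram which are simple closed curves without crossings.
* `left e` and `right e` are the regions of the complement on the two sides of the edge `e`.
  Around a crossing with both strands oriented upwards there are four corners (right, bottom, left,
  top), and each of them belongs to one region; see `corner_right` and so on.
* `connected`: one can walk from the unbounded region to any region by crossing edges.
* `euler` is Euler's formula `V - E + F = 1 + k` for a plane graph with `k` connected components: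
  here `V` is the number of crossings, `E = 2 V` (a closed curve without crossings
  contributes `0` to `V - E`), `F` is the number of regions. By additivity of the Euler
  characteristic this equality, with `connected`, says precisely that the edges together
  with the regions form a sphere, every region being a sphere with a disk removed for each
  connected piece of the diagram it touches; removing a point of the unbounded region
  gives the plane. Disconnected diagrams (in any nested position) are included. -/
structure OrientedLinkDiagram : Type 1 where
  Crossing : Type
  Edge : Type
  Region : Type
  [fintypeCrossing : Fintype Crossing]
  [finiteEdge : Finite Edge]
  [finiteRegion : Finite Region]
  /-- the sign of a crossing -/
  sign : Crossing → ℤˣ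
  /-- the edge that arrives at a crossing along a strand -/
  arriving : Crossing → Strand → Edge
  /-- the edge that departs from a crossing along a strand -/
  departing : Crossing → Strand → Edge
  left : Edge → Region
  right : Edge → Region
  unbounded : Region
  arriving_injective : Function.Injective2 arriving
  departing_injective : Function.Injective2 departing
  arrives_iff_departs : ∀ e, (∃ x s, arriving x s = e) ↔ (∃ x s, departing x s = e)
  corner_right : ∀ x, right (departing x (Strand.rising (sign x))) =
    right (arriving x (Strand.falling (sign x)))
  corner_bottom : ∀ x, right (arriving x (Strand.rising (sign x))) =
    left (arriving x (Strand.falling (sign x)))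
  corner_left : ∀ x, left (arriving x (Strand.rising (sign x))) =
    left (departing x (Strand.falling (sign x)))
  corner_top : ∀ x, left (departing x (Strand.rising (sign x))) =
    right (departing x (Strand.falling (sign x)))
  connected : ∀ r, Relation.EqvGen (fun r₁ r₂ => ∃ e, right e = r₁ ∧ left e = r₂) unbounded r
  euler : Nat.card Region = Nat.card Crossing + 1 +
    Nat.card (Quot (fun e₁ e₂ : Edge => ∃ x s₁ s₂,
      (e₁ = arriving x s₁ ∨ e₁ = departing x s₁) ∧ (e₂ = arriving x s₂ ∨ e₂ = departing x s₂)))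

namespace OrientedLinkDiagram

attribute [instance] fintypeCrossing finiteEdge finiteRegion

variable (D : OrientedLinkDiagram)

/-- The arcs of a diagram: edges are joined where they pass over a crossing. -/
def Arc : Type :=
  Quot (fun e₁ e₂ : D.Edge =>
    ∃ x, e₁ = D.arriving x Strand.over ∧ e₂ = D.departing x Strand.over)

instance : Finite D.Arc := inferInstanceAs (Finite (Quot _))

/-- The arc that contains an edge. -/
def arcOf (e : D.Edge) : D.Arc := Quot.mk _ e

/-- The over arc at a crossing. -/
def overArc (x : D.Crossing) : D.Arc := D.arcOf (D.arriving x Strand.over)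

/-- The under edge at a crossing which lies to the right of the over strand. -/
def underRight (x : D.Crossing) : D.Edge :=
  if D.sign x = 1 then D.arriving x Strand.under else D.departing x Strand.under

/-- The under edge at a crossing which lies to the left of the over strand. -/
def underLeft (x : D.Crossing) : D.Edge :=
  if D.sign x = 1 then D.departing x Strand.under else D.arriving x Strand.under

/-! ## Colorings

Normal vectors of arcs point to the left of the direction of the arc. Mathlib's quandles act from
the left: the quandle operation `x ∗ y` of knot theory is `Shelf.act y x`. -/

/-- `X`-colorings: `c (underRight) ∗ c (overArc) = c (underLeft)` at each crossing. -/
def IsColoring {X : Type u} [Quandle X] (c : D.Arc → X) : Prop :=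
  ∀ x : D.Crossing,
    Shelf.act (c (D.overArc x)) (c (D.arcOf (D.underRight x))) = c (D.arcOf (D.underLeft x))

/-- Shadow `X`-colorings: colorings of the arcs and the regions such that
`c (right) ∗ c (arc) = c (left)` along each arc. -/
@[ext]
structure ShadowColoring (X : Type u) [Quandle X] : Type u where
  arc : D.Arc → X
  region : D.Region → X
  isColoring : D.IsColoring arc
  act_right : ∀ e : D.Edge, Shelf.act (arc (D.arcOf e)) (region (D.right e)) = region (D.left e)

instance (X : Type u) [Quandle X] [Finite X] : Finite (D.ShadowColoring X) :=
  Finite.of_injective (fun c => (c.arc, c.region)) (by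
    intro c c' h
    simp only [Prod.mk.injEq] at h
    exact ShadowColoring.ext h.1 h.2)

/-- Shadow `X`-colorings whose unbounded region has the color `a`. -/
def ShadowColoringAt (X : Type u) [Quandle X] (a : X) : Type u :=
  {c : D.ShadowColoring X // c.region D.unbounded = a}

variable {D}

/-- The sum of the weights `± θ(x, y, z)` over all crossings, where the sign is that of the
crossing, `z` is the color of the over arc, `y` is the color of the under arc to the right of the
over arc, and `x` is the color of the region to the right of both strands (all normal vectors
point away from it). -/
def ShadowColoring.weight {X : Type u} [Quandle X] {A : Type v} [AddCommGroup A]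
    (θ : X → X → X → A) (c : D.ShadowColoring X) : A :=
  ∑ x : D.Crossing, ((D.sign x : ℤˣ) : ℤ) •
    θ (c.region (D.right (D.underRight x))) (c.arc (D.arcOf (D.underRight x)))
      (c.arc (D.overArc x))

variable (D)

/-- The shadow cocycle invariant of a diagram: the multiset of the weights of all shadow
colorings. -/
noncomputable def shadowCocycleInvariant {X : Type u} [Quandle X] [Finite X] {A : Type v}
    [AddCommGroup A] (θ : X → X → X → A) : Multiset A :=
  letI : Fintype (D.ShadowColoring X) := Fintype.ofFinite _
  (Finset.univ : Finset (D.ShadowColoring X)).val.map (fun c => c.weight θ)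

end OrientedLinkDiagram

/-! ## Quivers -/

/-- A quiver whose vertices carry labels in `A`. -/
structure LabelledQuiver (A : Type v) : Type (max (u + 1) v) where
  Vertex : Type u
  quiver : Quiver.{u} Vertex
  label : Vertex → A

/-- Isomorphism: a bijection of the vertices which is a quiver isomorphism and keeps labels. -/
def LabelledQuiver.Isomorphic {A : Type v} (Q Q' : LabelledQuiver.{u} A) : Prop :=
  ∃ φ : Q.Vertex ≃ Q'.Vertex,
    (∀ v w, Nonempty (Q.quiver.Hom v w ≃ Q'.quiver.Hom (φ v) (φ w))) ∧
    ∀ v, Q.label v = Q'.label (φ v)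

namespace OrientedLinkDiagram

variable (D : OrientedLinkDiagram)

/-- The shadow quandle cocycle quiver: the vertices are the shadow colorings with color `a` on the
unbounded region, labelled by their weights, and there is an edge from `v` to `w` when
`w = f ∘ v` on arcs for some `f ∈ S`. -/
def shadowCocycleQuiver {X : Type u} [Quandle X] {A : Type v} [AddCommGroup A]
    (S : Set (X →◃ X)) (θ : X → X → X → A) (a : X) : LabelledQuiver.{u} A where
  Vertex := D.ShadowColoringAt X a
  quiver := ⟨fun v w => ULift (PLift (∃ f ∈ S, w.1.arc = f ∘ v.1.arc))⟩
  label := fun c => c.1.weight θ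

/-- The same quiver with multiple edges: one edge from `v` to `w` for each `f ∈ S` with `w = f ∘ v`
on arcs. -/
def shadowCocycleMultiquiver {X : Type u} [Quandle X] {A : Type v} [AddCommGroup A]
    (S : Set (X →◃ X)) (θ : X → X → X → A) (a : X) : LabelledQuiver.{u} A where
  Vertex := D.ShadowColoringAt X a
  quiver := ⟨fun v w => {f : X →◃ X // f ∈ S ∧ w.1.arc = f ∘ v.1.arc}⟩
  label := fun c => c.1.weight θ

end OrientedLinkDiagram

/-! ## The dihedral quandle and Mochizuki's cocycle -/

instance (p : ℕ) [NeZero p] : Finite (Quandle.Dihedral p) := inferInstanceAs (Finite (ZMod p))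

/-- Mochizuki's 3-cocycle `θ_p(x, y, z) = (x - y) (y ^ p + (2 z - y) ^ p - 2 z ^ p) / p` of the
dihedral quandle `R_p`, for `p` prime. The quotient is formed with integers that represent `y` and
`z`; the division is exact by Fermat's little theorem. -/
def mochizukiCocycle (p : ℕ) (x y z : Quandle.Dihedral p) : ZMod p :=
  let x' : ZMod p := x
  let y' : ZMod p := y
  let z' : ZMod p := z
  (x' - y') * ((((y'.val : ℤ) ^ p + (2 * (z'.val : ℤ) - (y'.val : ℤ)) ^ p - 2 * (z'.val : ℤ) ^ p) /
    (p : ℤ) : ℤ) : ZMod p)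

/-! Only the arc colors matter for the weight. A plane diagram has a checkerboard coloring s of its
regions by ±1 (`exists_checkerboard`). Adding t·s to the region colors moves the unbounded color by
±t and keeps the weight (`weight_shift`). So for each a the vertices correspond to the space V of
arc colorings that extend to shadow colorings (`equivColoringSpace`). The label is a function Φ on
V, and the invariant contains each weight p times as often as it occurs on V.

Every endomorphism of R_p is affine, x ↦ l x + b, and acts on V by v ↦ l v + b e, where e is the
constant coloring 1. By `weight_affine`, Φ(l v + b e) = l² Φ(v). The edges of the quiver depend only
on this action of affine maps, so it suffices to find a bijection V ≃ V' that keeps labels and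
commutes with the action; it need not be linear.

Such a bijection exists as soon as all labels occur equally often
(`exists_affine_equiv_of_card_fiber_eq`): V is a union of planes through the line of e, any two of
which meet exactly in that line, and Φ on a plane is determined by its value at one vector off the
line. Planes are matched one at a time. Conversely, a label-preserving bijection of the vertices
already gives equal invariants. -/

/-! ### Sums over the ends of edges -/

/-- The two strands as booleans. -/
def Strand.equivBool : Strand ≃ Bool where
  toFun s := match s with
    | .over => true
    | .under => false
  invFun b := if b then .over else .under
  left_inv := by rintro (_ | _) <;> rfl
  right_inv := by rintro (_ | _) <;> rfl

instance : Fintype Strand := Fintype.ofEquiv Bool Strand.equivBool.symm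

theorem Strand.sum_eq {A : Type*} [AddCommMonoid A] (f : Strand → A) :
    ∑ s, f s = f Strand.over + f Strand.under := by
  rw [← Strand.equivBool.symm.sum_comp, Fintype.sum_bool]
  rfl

namespace OrientedLinkDiagram

variable {D : OrientedLinkDiagram}

/-- Both sums run once over the edges that have crossings, by injectivity and `arrives_iff_departs`.
-/
theorem sum_arriving_eq_sum_departing {A : Type*} [AddCommMonoid A] (F : D.Edge → A) :
    ∑ y : D.Crossing × Strand, F (D.arriving y.1 y.2) =
      ∑ y : D.Crossing × Strand, F (D.departing y.1 y.2) := by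
  classical
  rw [← Finset.sum_image (f := F) (g := fun y : D.Crossing × Strand => D.arriving y.1 y.2)
      fun a _ b _ h => Prod.ext_iff.2 (D.arriving_injective h),
    ← Finset.sum_image (f := F) (g := fun y : D.Crossing × Strand => D.departing y.1 y.2)
      fun a _ b _ h => Prod.ext_iff.2 (D.departing_injective h)]
  congr 1
  ext e
  simpa using D.arrives_iff_departs e

theorem sum_arriving_sub_departing {A : Type*} [AddCommGroup A] (F : D.Edge → A) :
    ∑ x, (F (D.arriving x Strand.over) + F (D.arriving x Strand.under) -
      (F (D.departing x Strand.over) + F (D.departing x Strand.under))) = 0 := by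
  have h := D.sum_arriving_eq_sum_departing F
  simp only [Fintype.sum_prod_type, Strand.sum_eq] at h
  rw [Finset.sum_sub_distrib, h, sub_self]

/-! ### Checkerboard colorings -/

/-- The mod 2 incidence matrix of crossings and edges. -/
def incidence (D : OrientedLinkDiagram) [DecidableEq D.Edge] :
    Matrix D.Crossing D.Edge (ZMod 2) :=
  Matrix.of fun x e =>
    ∑ s, ((if D.arriving x s = e then 1 else 0) + (if D.departing x s = e then 1 else 0))

theorem incidence_mulVec [DecidableEq D.Edge] [Fintype D.Edge] (f : D.Edge → ZMod 2)
    (x : D.Crossing) : (D.incidence.mulVec f) x =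
      ∑ s, (f (D.arriving x s) + f (D.departing x s)) := by
  simp only [incidence, Matrix.mulVec, dotProduct, Matrix.of_apply, Finset.sum_mul, add_mul,
    ite_mul, one_mul, zero_mul]
  rw [Finset.sum_comm]
  simp [Finset.sum_add_distrib]

/-- An edge has one end at x and one at y, so a vector in the kernel of the transpose takes equal
values at both. -/
theorem incidence_transpose_mulVec [DecidableEq D.Edge] (t : D.Crossing → ZMod 2)
    {x y : D.Crossing} {s s' : Strand} (h : D.arriving x s = D.departing y s') :
    (D.incidence.transpose.mulVec t) (D.arriving x s) = t x + t y := by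
  classical
  have h₁ : ∀ x' s'', (D.arriving x' s'' = D.arriving x s) ↔ ((x', s'') = (x, s)) := fun x' s'' =>
    ⟨fun h => Prod.ext_iff.2 (D.arriving_injective h), fun h => by
      rw [Prod.mk.injEq] at h; rw [h.1, h.2]⟩
  have h₂ : ∀ x' s'', (D.departing x' s'' = D.arriving x s) ↔ ((x', s'') = (y, s')) := fun x' s'' =>
    ⟨fun h' => Prod.ext_iff.2 (D.departing_injective (h'.trans h)), fun h' => by
      rw [Prod.mk.injEq] at h'; rw [h'.1, h'.2, h]⟩
  simp only [incidence, Matrix.mulVec, dotProduct, Matrix.transpose_apply, Matrix.of_apply,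
    Finset.sum_mul, add_mul, ite_mul, one_mul, zero_mul, h₁, h₂, Finset.sum_add_distrib]
  rw [← Fintype.sum_prod_type' (f := fun a b => if (a, b) = (x, s) then t a else 0),
    ← Fintype.sum_prod_type' (f := fun a b => if (a, b) = (y, s') then t a else 0)]
  simp

/-- The connected components of the underlying curves. -/
abbrev Component (D : OrientedLinkDiagram) : Type :=
  Quot (fun e₁ e₂ : D.Edge => ∃ x s₁ s₂,
      (e₁ = D.arriving x s₁ ∨ e₁ = D.departing x s₁) ∧
      (e₂ = D.arriving x s₂ ∨ e₂ = D.departing x s₂))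

/-- The edges without crossings. -/
abbrev FreeEdge (D : OrientedLinkDiagram) : Type := {e : D.Edge // ¬ ∃ x s, D.arriving x s = e}

theorem card_edge : Nat.card D.Edge = 2 * Nat.card D.Crossing + Nat.card D.FreeEdge := by
  classical
  let g : D.Crossing × Strand → D.Edge := fun y => D.arriving y.1 y.2
  have hg : Function.Injective g := fun a b h => Prod.ext_iff.2 (D.arriving_injective h)
  have h : Nat.card {e : D.Edge // ∃ x s, D.arriving x s = e} = 2 * Nat.card D.Crossing := by
    have := Nat.card_congr (Equiv.ofInjective g hg)
    rw [Nat.card_prod, Nat.card_congr Strand.equivBool, Nat.card_eq_fintype_card (α := Bool),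
      Fintype.card_bool] at this
    rw [mul_comm]
    refine Eq.trans ?_ this.symm
    refine Nat.card_congr (Equiv.subtypeEquivRight fun e => ?_)
    simp [g]
  rw [← h, ← Nat.card_sum]
  exact Nat.card_congr (Equiv.sumCompl _).symm

/-- A kernel vector is constant on connected components, and a free edge is a component by itself.
So kernel vectors and arbitrary functions on the free edges together come from functions on the set
of components. -/
theorem finrank_ker_transpose_add_card_freeEdge_le [DecidableEq D.Edge] [Fintype D.Edge] :
    Module.finrank (ZMod 2) (LinearMap.ker D.incidence.transpose.mulVecLin) +
      Nat.card D.FreeEdge ≤ Nat.card D.Component := by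
  classical
  let _ := Fintype.ofFinite D.Component
  let K := LinearMap.ker D.incidence.transpose.mulVecLin
  let P : (D.Component → ZMod 2) →ₗ[ZMod 2] (D.Crossing → ZMod 2) × (D.FreeEdge → ZMod 2) :=
    (LinearMap.funLeft (ZMod 2) (ZMod 2) fun x => Quot.mk _ (D.arriving x Strand.over)).prod
      (LinearMap.funLeft (ZMod 2) (ZMod 2) fun e => Quot.mk _ e.1)
  have hP : LinearMap.range (K.subtype.prodMap LinearMap.id) ≤ LinearMap.range P := by
    rintro _ ⟨⟨⟨t, ht⟩, n⟩, rfl⟩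
    have ht : D.incidence.transpose.mulVec t = 0 := ht
    let g : D.Edge → ZMod 2 := fun e =>
      if h : ∃ x s, D.arriving x s = e then t h.choose else n ⟨e, h⟩
    have harr : ∀ x s, g (D.arriving x s) = t x := by
      intro x s
      have h : ∃ x' s', D.arriving x' s' = D.arriving x s := ⟨x, s, rfl⟩
      obtain ⟨s', hs'⟩ := h.choose_spec
      simp only [g, dif_pos h]
      rw [(D.arriving_injective hs').1]
    have hdep : ∀ x s, g (D.departing x s) = t x := by
      intro x s
      obtain ⟨x', s', h⟩ := (D.arrives_iff_departs _).2 ⟨x, s, rfl⟩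
      have h0 := D.incidence_transpose_mulVec t h
      rw [ht, Pi.zero_apply] at h0
      rw [← h, harr]
      exact (CharTwo.add_eq_zero).1 h0.symm
    refine ⟨Quot.lift g ?_, ?_⟩
    · rintro e₁ e₂ ⟨x, s₁, s₂, rfl | rfl, rfl | rfl⟩ <;> simp only [harr, hdep]
    · refine Prod.ext (funext fun x => harr x _) (funext fun e => ?_)
      change g e.1 = n e
      simp only [g, dif_neg e.2]
  have h₁ := Submodule.finrank_mono hP
  have h₂ := LinearMap.finrank_range_le P
  rw [LinearMap.finrank_range_of_inj
    (Function.Injective.prodMap K.injective_subtype Function.injective_id),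
    Module.finrank_prod, Module.finrank_fintype_fun_eq_card (ZMod 2) (η := D.FreeEdge),
    ← Nat.card_eq_fintype_card] at h₁
  rw [Module.finrank_fintype_fun_eq_card, ← Nat.card_eq_fintype_card] at h₂
  change Module.finrank (ZMod 2) K + _ ≤ _
  omega

/-- Each of the four corners at a crossing lies between two edge ends, so its color is counted
twice. -/
theorem incidence_mulVec_boundary [DecidableEq D.Edge] [Fintype D.Edge] (s : D.Region → ZMod 2) :
    D.incidence.mulVec (fun e => s (D.left e) + s (D.right e)) = 0 := by
  funext x
  rw [incidence_mulVec, Strand.sum_eq, Pi.zero_apply]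
  have h₁ := D.corner_right x
  have h₂ := D.corner_bottom x
  have h₃ := D.corner_left x
  have h₄ := D.corner_top x
  have two : (2 : ZMod 2) = 0 := rfl
  rcases Int.units_eq_one_or (D.sign x) with h | h <;>
  · simp only [h, Strand.rising, Strand.falling, reduceIte, show ((-1 : ℤˣ) = 1) = False by simp]
      at h₁ h₂ h₃ h₄
    rw [h₁, h₂, h₃, h₄]
    ring_nf
    simp [two]

theorem eq_of_invariant {α : Type*} (s : D.Region → α) (P : α → Prop)
    (h : ∀ e, P (s (D.right e)) ↔ P (s (D.left e))) (r : D.Region) :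
    P (s r) ↔ P (s D.unbounded) := by
  have h' := D.connected r
  generalize D.unbounded = r₀ at h' ⊢
  induction h' with
  | rel a b h' => obtain ⟨e, rfl, rfl⟩ := h'; exact (h e).symm
  | refl => rfl
  | symm a b _ ih => exact ih.symm
  | trans a b c _ _ ih₁ ih₂ => exact ih₂.trans ih₁

/-- Boundaries of region functions lie in the cycle space Z, the kernel of the incidence matrix.
With V, E, F, k the numbers of crossings, edges, regions and components, connectedness gives
boundaries of dimension at least F - 1. On the other side, Z has dimension E - V + dim ker of the
transpose, at most V + k = F - 1 by `euler`. So every cycle is a boundary. The all-ones vector is a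
cycle because a crossing has four edge ends. -/
theorem exists_checkerboard_zmod_two (D : OrientedLinkDiagram) :
    ∃ s : D.Region → ZMod 2, ∀ e, s (D.left e) + s (D.right e) = 1 := by
  classical
  let _ := Fintype.ofFinite D.Edge
  let _ := Fintype.ofFinite D.Region
  let d : (D.Region → ZMod 2) →ₗ[ZMod 2] (D.Edge → ZMod 2) :=
    LinearMap.funLeft (ZMod 2) (ZMod 2) D.left + LinearMap.funLeft (ZMod 2) (ZMod 2) D.right
  let Z := LinearMap.ker D.incidence.mulVecLin
  have hd : LinearMap.range d ≤ Z := by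
    rintro _ ⟨s, rfl⟩
    exact D.incidence_mulVec_boundary s
  have hone : (1 : D.Edge → ZMod 2) ∈ Z := by
    change D.incidence.mulVec 1 = 0
    funext x
    rw [incidence_mulVec, Strand.sum_eq]
    rfl
  have hker : Module.finrank (ZMod 2) (LinearMap.ker d) ≤ 1 := by
    have : LinearMap.ker d ≤ Submodule.span (ZMod 2) {1} := by
      intro s hs
      rw [Submodule.mem_span_singleton]
      refine ⟨s D.unbounded, funext fun r => ?_⟩
      have hs : d s = 0 := hs
      have := D.eq_of_invariant s (fun z => z = s D.unbounded) (fun e => by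
        have : s (D.left e) + s (D.right e) = 0 := congrFun hs e
        rw [CharTwo.add_eq_zero.1 this]) r
      simp [this.2 rfl]
    exact (Submodule.finrank_mono this).trans ((finrank_span_le_card _).trans (by simp))
  have h₁ := d.finrank_range_add_finrank_ker
  have h₂ := D.incidence.mulVecLin.finrank_range_add_finrank_ker
  have h₃ := D.incidence.transpose.mulVecLin.finrank_range_add_finrank_ker
  have h₄ := D.incidence.rank_transpose
  have h₅ := D.finrank_ker_transpose_add_card_freeEdge_le
  have h₆ := D.card_edge
  have h₇ := D.euler
  simp only [Matrix.rank] at h₄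
  rw [Module.finrank_fintype_fun_eq_card, ← Nat.card_eq_fintype_card] at h₁ h₂ h₃
  have hle : Module.finrank (ZMod 2) Z ≤ Module.finrank (ZMod 2) (LinearMap.range d) := by
    change Module.finrank (ZMod 2) (LinearMap.ker _) ≤ _
    change Nat.card D.Region = Nat.card D.Crossing + 1 + Nat.card D.Component at h₇
    omega
  rw [← Submodule.eq_of_le_of_finrank_le hd hle] at hone
  obtain ⟨s, hs⟩ := hone
  exact ⟨s, fun e => congrFun hs e⟩

/-- Integer values are needed because `weight_shift` divides by p a sum that has to vanish in ℤ. -/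
theorem exists_checkerboard (D : OrientedLinkDiagram) :
    ∃ s : D.Region → ℤ, s D.unbounded = 1 ∧ ∀ e, s (D.left e) = - s (D.right e) := by
  obtain ⟨s, hs⟩ := D.exists_checkerboard_zmod_two
  refine ⟨fun r => if s r = s D.unbounded then 1 else -1, by simp, fun e => ?_⟩
  have h := hs e
  dsimp only
  revert h
  generalize s (D.left e) = a
  generalize s (D.right e) = b
  generalize s D.unbounded = c
  revert a b c
  decide

end OrientedLinkDiagram

/-! ### Matching labelled vector spaces compatibly with affine maps -/

/-- A nonempty relation between two modules with distinguished vectors that is compatible with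
affine combinations, keeps labels and is one-to-one. -/
structure IsAffineMatching {K V V' : Type*} [Field K] [AddCommGroup V] [Module K V]
    [AddCommGroup V'] [Module K V'] (e : V) (e' : V') (Φ : V → K) (Φ' : V' → K)
    (R : Set (V × V')) : Prop where
  zero_mem : (0, 0) ∈ R
  label : ∀ z ∈ R, Φ z.1 = Φ' z.2
  affine : ∀ z ∈ R, ∀ l b : K, (l • z.1 + b • e, l • z.2 + b • e') ∈ R
  snd_unique : ∀ z ∈ R, ∀ z' ∈ R, z.1 = z'.1 → z.2 = z'.2
  fst_unique : ∀ z ∈ R, ∀ z' ∈ R, z.2 = z'.2 → z.1 = z'.1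

namespace IsAffineMatching

variable {K V V' : Type*} [Field K] [AddCommGroup V] [Module K V]
  [AddCommGroup V'] [Module K V'] {e : V} {e' : V'} {Φ : V → K} {Φ' : V' → K} {R : Set (V × V')}

theorem const_mem (h : IsAffineMatching e e' Φ Φ' R) (b : K) : (b • e, b • e') ∈ R := by
  simpa using h.affine _ h.zero_mem 0 b

/-- The orbit of a pair under affine maps. -/
def orbit (e : V) (e' : V') (x : V) (x' : V') : Set (V × V') :=
  Set.range fun c : K × K => (c.1 • x + c.2 • e, c.1 • x' + c.2 • e')

theorem swap (h : IsAffineMatching e e' Φ Φ' R) :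
    IsAffineMatching e' e Φ' Φ (Prod.swap ⁻¹' R) where
  zero_mem := h.zero_mem
  label _ hz := (h.label _ hz).symm
  affine _ hz := h.affine _ hz
  snd_unique _ hz _ hz' := h.fst_unique _ hz _ hz'
  fst_unique _ hz _ hz' := h.snd_unique _ hz _ hz'

/-- For l ≠ 0 the affine map is invertible and would give x a partner in R. Only l = 0 remains,
which is the line of e. -/
theorem eq_of_mem_of_mem_orbit (h : IsAffineMatching e e' Φ Φ' R) {x : V} {x' : V'}
    (hx : ∀ y, (x, y) ∉ R) (l b : K) {z : V × V'} (hz : z ∈ R) (hz' : z.1 = l • x + b • e) :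
    z.2 = l • x' + b • e' := by
  rcases eq_or_ne l 0 with rfl | hl
  · rw [zero_smul, zero_add] at hz' ⊢
    exact h.snd_unique _ hz _ (h.const_mem b) hz'
  · have := h.affine z hz l⁻¹ (-(l⁻¹ * b))
    rw [hz', smul_add, smul_smul, smul_smul, inv_mul_cancel₀ hl, one_smul, add_assoc, ← add_smul,
      add_neg_cancel, zero_smul, add_zero] at this
    exact absurd this (hx _)

/-- The line of e is already matched by `const_mem`, so x lies off it and is linearly independent of
e. -/
theorem coeff_eq (h : IsAffineMatching e e' Φ Φ' R) (he : e ≠ 0) {x : V}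
    (hx : ∀ y, (x, y) ∉ R) {l b l' b' : K} (heq : l • x + b • e = l' • x + b' • e) :
    l = l' ∧ b = b' := by
  have hl : l = l' := by
    by_contra hne
    have hne' : l - l' ≠ 0 := sub_ne_zero.2 hne
    have h₁ : (l - l') • x = (b' - b) • e := by
      rw [sub_smul, sub_smul, sub_eq_sub_iff_add_eq_add, heq, add_comm]
    refine hx _ (?_ : (x, ((l - l')⁻¹ * (b' - b)) • e') ∈ R)
    have : x = ((l - l')⁻¹ * (b' - b)) • e := by
      rw [mul_smul, ← h₁, smul_smul, inv_mul_cancel₀ hne', one_smul]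
    nth_rewrite 1 [this]
    exact h.const_mem _
  subst hl
  exact ⟨rfl, smul_left_injective K he (add_left_cancel heq)⟩

/-- The plane of x and e meets the domain of R only in the line of e, where both matchings send b •
e to b • e'. -/
theorem snd_unique_union (h : IsAffineMatching e e' Φ Φ' R) (he : e ≠ 0) {x : V} {x' : V'}
    (hx : ∀ y, (x, y) ∉ R) : ∀ z ∈ R ∪ orbit (K := K) e e' x x',
      ∀ z' ∈ R ∪ orbit (K := K) e e' x x', z.1 = z'.1 → z.2 = z'.2 := by
  rintro z (hz | ⟨⟨l, b⟩, rfl⟩) z' (hz' | ⟨⟨l', b'⟩, rfl⟩) heq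
  · exact h.snd_unique z hz z' hz' heq
  · exact h.eq_of_mem_of_mem_orbit hx l' b' hz heq
  · exact (h.eq_of_mem_of_mem_orbit hx l b hz' heq.symm).symm
  · obtain ⟨rfl, rfl⟩ := h.coeff_eq he hx heq
    rfl

theorem union (h : IsAffineMatching e e' Φ Φ' R) (he : e ≠ 0) (he' : e' ≠ 0)
    (hΦ : ∀ (l b : K) v, Φ (l • v + b • e) = l ^ 2 * Φ v)
    (hΦ' : ∀ (l b : K) v, Φ' (l • v + b • e') = l ^ 2 * Φ' v) {x : V} {x' : V'}
    (hx : ∀ y, (x, y) ∉ R) (hx' : ∀ y, (y, x') ∉ R) (hxx' : Φ x = Φ' x') :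
    IsAffineMatching e e' Φ Φ' (R ∪ orbit (K := K) e e' x x') where
  zero_mem := Or.inl h.zero_mem
  label := by
    rintro z (hz | ⟨⟨l, b⟩, rfl⟩)
    · exact h.label z hz
    · simp only [hΦ, hΦ', hxx']
  affine := by
    rintro z (hz | ⟨⟨l, b⟩, rfl⟩) m c
    · exact Or.inl (h.affine z hz m c)
    · refine Or.inr ⟨(m * l, m * b + c), ?_⟩
      simp only [smul_add, mul_smul, add_smul, add_assoc]
  snd_unique := h.snd_unique_union he hx
  fst_unique := by
    have key := h.swap.snd_unique_union he' (x := x') (x' := x) fun y => hx' y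
    have hsub : ∀ z : V × V', z ∈ R ∪ orbit (K := K) e e' x x' →
        z.swap ∈ Prod.swap ⁻¹' R ∪ orbit (K := K) e' e x' x := by
      rintro z (hz | ⟨c, rfl⟩)
      · exact Or.inl (by simpa using hz)
      · exact Or.inr ⟨c, rfl⟩
    intro z hz z' hz' heq
    exact key z.swap (hsub z hz) z'.swap (hsub z' hz') heq

end IsAffineMatching

/-- Two finite vector spaces with distinguished nonzero vectors and labels that are quadratic for
affine maps are isomorphic as soon as each label occurs equally often. -/
theorem exists_affine_equiv_of_card_fiber_eq {K V V' : Type*} [Field K] [AddCommGroup V]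
    [Module K V] [AddCommGroup V'] [Module K V'] [Finite V] [Finite V'] {e : V} {e' : V'}
    (he : e ≠ 0) (he' : e' ≠ 0) {Φ : V → K} {Φ' : V' → K}
    (hΦ : ∀ (l b : K) v, Φ (l • v + b • e) = l ^ 2 * Φ v)
    (hΦ' : ∀ (l b : K) v, Φ' (l • v + b • e') = l ^ 2 * Φ' v)
    (hcard : ∀ k, Nat.card {v // Φ v = k} = Nat.card {v // Φ' v = k}) :
    ∃ φ : V ≃ V', (∀ v, Φ v = Φ' (φ v)) ∧
      ∀ (l b : K) v, φ (l • v + b • e) = l • φ v + b • e' := by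
  have h0 : Φ 0 = 0 := by simpa using hΦ 0 0 0
  have h0' : Φ' 0 = 0 := by simpa using hΦ' 0 0 0
  have base : IsAffineMatching e e' Φ Φ' (Set.range fun b : K => (b • e, b • e')) :=
    { zero_mem := ⟨0, by simp⟩
      label := by
        rintro _ ⟨b, rfl⟩
        have h₁ := hΦ 0 b 0
        have h₂ := hΦ' 0 b 0
        simp_all
      affine := by
        rintro _ ⟨b, rfl⟩ l c
        exact ⟨l * b + c, by simp [add_smul, mul_smul]⟩
      snd_unique := by
        rintro _ ⟨b, rfl⟩ _ ⟨c, rfl⟩ h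
        rw [smul_left_injective K he h]
      fst_unique := by
        rintro _ ⟨b, rfl⟩ _ ⟨c, rfl⟩ h
        rw [smul_left_injective K he' h] }
  obtain ⟨R, hR⟩ := (Set.toFinite {R | IsAffineMatching e e' Φ Φ' R}).exists_maximal ⟨_, base⟩
  have hm : IsAffineMatching e e' Φ Φ' R := hR.prop
  have total : ∀ x, ∃ y, (x, y) ∈ R := by
    by_contra! hx
    obtain ⟨x, hx⟩ := hx
    -- If all vectors with label Φ x on the other side were matched, their partners would, by equal
    -- cardinality, exhaust the fiber of Φ and include x.
    have : ∃ x', Φ' x' = Φ x ∧ ∀ y, (y, x') ∉ R := by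
      by_contra! hcon
      choose! f hf using hcon
      have hinj : Function.Injective fun v : {v // Φ' v = Φ x} =>
          (⟨f v.1, (hm.label _ (hf v.1 v.2)).trans v.2⟩ : {v // Φ v = Φ x}) := by
        intro v w hvw
        exact Subtype.ext
          (hm.snd_unique _ (hf v.1 v.2) _ (hf w.1 w.2) (Subtype.ext_iff.1 hvw))
      obtain ⟨v, hv⟩ := (hinj.bijective_of_nat_card_le (hcard _).le).2 ⟨x, rfl⟩
      have := hf v.1 v.2
      rw [show f v.1 = x from Subtype.ext_iff.1 hv] at this
      exact hx _ this
    obtain ⟨x', hxx', hx'⟩ := this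
    have hle := hR.le_of_ge (hm.union he he' hΦ hΦ' hx hx' hxx'.symm) Set.subset_union_left
    exact hx x' (hle (Or.inr ⟨(1, 0), by simp⟩))
  choose f hf using total
  have hinj : Function.Injective f := fun v w h => hm.fst_unique _ (hf v) _ (hf w) h
  have hcard' : Nat.card V' ≤ Nat.card V := by
    rw [← Nat.card_congr (Equiv.sigmaFiberEquiv Φ), ← Nat.card_congr (Equiv.sigmaFiberEquiv Φ')]
    exact (Nat.card_congr (Equiv.sigmaCongrRight fun k =>
      (Finite.card_eq.1 (hcard k)).some.symm)).le
  refine ⟨Equiv.ofBijective f (hinj.bijective_of_nat_card_le hcard'), fun v => hm.label _ (hf v),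
    fun l b v => hm.snd_unique _ (hf _) _ (hm.affine _ (hf v) l b) rfl⟩

/-! ### Mochizuki's cocycle -/

section FermatQuotient

variable (p : ℕ)

/-- The integer quotient by `p`, reduced modulo `p`. -/
def quotientMod (m : ℤ) : ZMod p := ((m / (p : ℤ) : ℤ) : ZMod p)

variable {p}

theorem quotientMod_add {m : ℤ} (h : (p : ℤ) ∣ m) (n : ℤ) :
    quotientMod p (m + n) = quotientMod p m + quotientMod p n := by
  simp [quotientMod, Int.add_ediv_of_dvd_left h]

theorem quotientMod_mul {m : ℤ} (h : (p : ℤ) ∣ m) (n : ℤ) :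
    quotientMod p (n * m) = n * quotientMod p m := by
  simp [quotientMod, Int.mul_ediv_assoc n h]

theorem quotientMod_congr [NeZero p] {m n : ℤ} (h : (p : ℤ) ^ 2 ∣ m - n) :
    quotientMod p m = quotientMod p n := by
  obtain ⟨k, hk⟩ := h
  obtain rfl : m = n + p * (p * k) := by linear_combination hk
  simp [quotientMod, Int.add_mul_ediv_left _ _ (show (p : ℤ) ≠ 0 from mod_cast NeZero.ne p)]

theorem quotientMod_sum {ι : Type*} (s : Finset ι) (f : ι → ℤ) (h : ∀ i ∈ s, (p : ℤ) ∣ f i) :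
    quotientMod p (∑ i ∈ s, f i) = ∑ i ∈ s, quotientMod p (f i) := by
  classical
  induction s using Finset.induction_on with
  | empty => simp [quotientMod]
  | insert a s ha ih =>
    rw [Finset.sum_insert ha, Finset.sum_insert ha,
      quotientMod_add (h a (Finset.mem_insert_self a s)),
      ih fun i hi => h i (Finset.mem_insert_of_mem hi)]

/-- An integer with residue `y` modulo `p` whose residue modulo `p ^ 2` is the Teichmüller
representative of `y`. -/
def frobeniusLift (y : ZMod p) : ℤ := (y.val : ℤ) ^ p

variable [Fact p.Prime]

theorem frobeniusLift_cast (y : ZMod p) : (frobeniusLift y : ZMod p) = y := by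
  simp [frobeniusLift, ZMod.pow_card]

/-- Congruence modulo p becomes congruence modulo p² after taking p-th powers, so the choice of
representative is irrelevant. -/
theorem sq_dvd_pow_sub_frobeniusLift {m : ℤ} {y : ZMod p} (h : (m : ZMod p) = y) :
    (p : ℤ) ^ 2 ∣ m ^ p - frobeniusLift y := by
  have h₁ : (p : ℤ) ∣ m - (y.val : ℤ) := by
    rw [← ZMod.intCast_zmod_eq_zero_iff_dvd]
    simp [h]
  have h₂ := dvd_sub_pow_of_dvd_sub h₁ 1
  rw [pow_one] at h₂
  exact h₂

theorem sq_dvd_frobeniusLift_mul (l y : ZMod p) :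
    (p : ℤ) ^ 2 ∣ frobeniusLift l * frobeniusLift y - frobeniusLift (l * y) := by
  rw [frobeniusLift, frobeniusLift, ← mul_pow]
  exact sq_dvd_pow_sub_frobeniusLift (by simp)

theorem dvd_frobeniusLift_of_add_eq {y y' z : ZMod p} (h : y + y' = 2 * z) :
    (p : ℤ) ∣ frobeniusLift y + frobeniusLift y' - 2 * frobeniusLift z := by
  rw [← ZMod.intCast_zmod_eq_zero_iff_dvd]
  push_cast
  simp only [frobeniusLift_cast]
  rw [h, sub_self]

/-- Writing y' for 2z - y makes the quotient symmetric in the two under arcs. -/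
theorem mochizukiCocycle_eq {x y z y' : ZMod p} (h : y + y' = 2 * z) :
    mochizukiCocycle p x y z =
      (x - y) * quotientMod p (frobeniusLift y + frobeniusLift y' - 2 * frobeniusLift z) := by
  have h' : (((2 * (z.val : ℤ) - y.val : ℤ)) : ZMod p) = y' := by
    push_cast
    simp only [ZMod.natCast_val, ZMod.cast_id', id]
    linear_combination -h
  refine congrArg ((x - y) * ·) (quotientMod_congr ?_)
  have := sq_dvd_pow_sub_frobeniusLift h'
  convert this using 1
  simp only [frobeniusLift]
  ring

/-- Teichmüller representatives are multiplicative modulo p², so that of l factors out of the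
quotient. -/
theorem quotientMod_frobeniusLift_mul (l : ZMod p) {y y' z : ZMod p} (h : y + y' = 2 * z) :
    quotientMod p (frobeniusLift (l * y) + frobeniusLift (l * y') - 2 * frobeniusLift (l * z)) =
      l * quotientMod p (frobeniusLift y + frobeniusLift y' - 2 * frobeniusLift z) := by
  have := quotientMod_mul (dvd_frobeniusLift_of_add_eq h) (frobeniusLift l)
  rw [frobeniusLift_cast] at this
  rw [← this]
  symm
  refine quotientMod_congr ?_
  have h' := dvd_sub (dvd_add (sq_dvd_frobeniusLift_mul l y) (sq_dvd_frobeniusLift_mul l y'))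
    ((sq_dvd_frobeniusLift_mul l z).mul_left 2)
  refine h'.trans (dvd_of_eq ?_)
  ring

/-- The defect of additivity of the Teichmüller representative. -/
def translationDefect (b y : ZMod p) : ZMod p :=
  quotientMod p (frobeniusLift (y + b) - frobeniusLift y - frobeniusLift b)

theorem dvd_translationDefect (b y : ZMod p) :
    (p : ℤ) ∣ frobeniusLift (y + b) - frobeniusLift y - frobeniusLift b := by
  rw [← ZMod.intCast_zmod_eq_zero_iff_dvd]
  push_cast
  simp only [frobeniusLift_cast]
  ring

/-- The terms `frobeniusLift b` cancel because 1 + 1 - 2 = 0. The change is a combination of values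
of one function of the colors, the form that `sum_right_sub_mul_eq_zero` annihilates. -/
theorem quotientMod_frobeniusLift_add (b : ZMod p) {y y' z : ZMod p} (h : y + y' = 2 * z) :
    quotientMod p (frobeniusLift (y + b) + frobeniusLift (y' + b) - 2 * frobeniusLift (z + b)) =
      quotientMod p (frobeniusLift y + frobeniusLift y' - 2 * frobeniusLift z) +
        (translationDefect b y + translationDefect b y' - 2 * translationDefect b z) := by
  have h₁ := quotientMod_mul (dvd_translationDefect b z) (-2)
  rw [show frobeniusLift (y + b) + frobeniusLift (y' + b) - 2 * frobeniusLift (z + b) =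
    (frobeniusLift y + frobeniusLift y' - 2 * frobeniusLift z) +
      ((frobeniusLift (y + b) - frobeniusLift y - frobeniusLift b) +
        ((frobeniusLift (y' + b) - frobeniusLift y' - frobeniusLift b) +
          (-2) * (frobeniusLift (z + b) - frobeniusLift z - frobeniusLift b))) by ring,
    quotientMod_add (dvd_frobeniusLift_of_add_eq h), quotientMod_add (dvd_translationDefect b y),
    quotientMod_add (dvd_translationDefect b y'), h₁]
  simp only [translationDefect]
  push_cast
  ring

end FermatQuotient

/-! ### Endomorphisms of the dihedral quandle -/

theorem Quandle.Dihedral.exists_affine {p : ℕ} [NeZero p]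
    (f : Quandle.Dihedral p →◃ Quandle.Dihedral p) :
    ∃ l b : ZMod p, ∀ x : ZMod p, f x = (l * x + b : ZMod p) := by
  let g : ZMod p → ZMod p := f
  have hg : ∀ x y : ZMod p, g (2 * x - y) = 2 * g x - g y := fun x y => f.map_act (x := x) (y := y)
  -- Two consecutive values are carried along, since n + 2 = 2(n + 1) - n determines the next one.
  have key : ∀ n : ℕ, g n = (g 1 - g 0) * n + g 0 ∧
      g ((n + 1 : ℕ) : ZMod p) = (g 1 - g 0) * ((n + 1 : ℕ) : ZMod p) + g 0 := by
    intro n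
    induction n with
    | zero => simp
    | succ n ih =>
      refine ⟨ih.2, ?_⟩
      have := hg ((n + 1 : ℕ) : ZMod p) n
      rw [ih.1, ih.2] at this
      rw [show ((n + 1 + 1 : ℕ) : ZMod p) = 2 * ((n + 1 : ℕ) : ZMod p) - n by push_cast; ring, this]
      push_cast
      ring
  refine ⟨g 1 - g 0, g 0, fun x => ?_⟩
  have := (key x.val).1
  rwa [ZMod.natCast_zmod_val] at this

namespace OrientedLinkDiagram

variable {D : OrientedLinkDiagram}

/-! ### Sums over crossings -/

/-- The corner relations give the same identities for both signs of the crossing: the factor x - y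
of the cocycle changes sign along the under strand. -/
theorem right_sub_eq {R : Type*} [CommRing R] {c : D.Edge → R} {r : D.Region → R}
    (hc : ∀ x, c (D.arriving x Strand.under) + c (D.departing x Strand.under) =
      2 * c (D.arriving x Strand.over))
    (hc' : ∀ x, c (D.departing x Strand.over) = c (D.arriving x Strand.over))
    (hr : ∀ e, r (D.left e) = 2 * c e - r (D.right e)) (x : D.Crossing) :
    r (D.right (D.departing x Strand.under)) - c (D.departing x Strand.under) =
        -(r (D.right (D.arriving x Strand.under)) - c (D.arriving x Strand.under)) ∧
      r (D.right (D.arriving x Strand.over)) - r (D.right (D.departing x Strand.over)) =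
        -2 * (r (D.right (D.arriving x Strand.under)) - c (D.arriving x Strand.under)) := by
  have h₀ := hc x
  have h₁ := congrArg r (D.corner_right x)
  have h₂ := congrArg r (D.corner_bottom x)
  have h₄ := congrArg r (D.corner_top x)
  rcases Int.units_eq_one_or (D.sign x) with h | h <;>
    simp only [h, Strand.rising, Strand.falling, reduceIte, show ((-1 : ℤˣ) = 1) = False by simp,
      hr, hc'] at h₁ h₂ h₄
  · constructor
    · linear_combination -h₀ - h₁ - h₄
    · linear_combination h₂ - h₁
  · constructor
    · linear_combination h₁ - h₀ + h₂
    · linear_combination h₄ + h₁ + 2 * h₂ - 2 * h₀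

/-- With F e = (r (right e) - c e) * H e, the summand is F on the arriving edges minus F on the
departing ones, so the sum telescopes. It serves for translations (H a translation defect) and for
checkerboard shifts (c = 0, over ℤ). -/
theorem sum_right_sub_mul_eq_zero {R : Type*} [CommRing R] {c : D.Edge → R} {r : D.Region → R}
    (hc : ∀ x, c (D.arriving x Strand.under) + c (D.departing x Strand.under) =
      2 * c (D.arriving x Strand.over))
    (hc' : ∀ x, c (D.departing x Strand.over) = c (D.arriving x Strand.over))
    (hr : ∀ e, r (D.left e) = 2 * c e - r (D.right e)) (H : D.Edge → R)
    (hH : ∀ x, H (D.departing x Strand.over) = H (D.arriving x Strand.over)) :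
    ∑ x, (r (D.right (D.arriving x Strand.under)) - c (D.arriving x Strand.under)) *
      (H (D.arriving x Strand.under) + H (D.departing x Strand.under) -
        2 * H (D.arriving x Strand.over)) = 0 := by
  rw [← D.sum_arriving_sub_departing fun e => (r (D.right e) - c e) * H e]
  refine Finset.sum_congr rfl fun x _ => ?_
  obtain ⟨h₁, h₂⟩ := D.right_sub_eq hc hc' hr x
  rw [h₁, hH, hc']
  linear_combination -H (D.arriving x Strand.over) * h₂

theorem arcOf_departing_over (x : D.Crossing) :
    D.arcOf (D.departing x Strand.over) = D.arcOf (D.arriving x Strand.over) :=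
  (Quot.sound ⟨x, rfl, rfl⟩).symm

/-! ### Shadow colorings by dihedral quandles -/

namespace ShadowColoring

variable {p : ℕ}

/-- The colors of the arcs as elements of `ZMod p`. -/
def arcColor (v : D.ShadowColoring (Quandle.Dihedral p)) : D.Arc → ZMod p := v.arc

/-- The colors of the edges as elements of `ZMod p`. -/
def edgeColor (v : D.ShadowColoring (Quandle.Dihedral p)) (e : D.Edge) : ZMod p :=
  v.arcColor (D.arcOf e)

/-- The colors of the regions as elements of `ZMod p`. -/
def regionColor (v : D.ShadowColoring (Quandle.Dihedral p)) (r : D.Region) : ZMod p := v.region r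

theorem edgeColor_add (v : D.ShadowColoring (Quandle.Dihedral p)) (x : D.Crossing) :
    v.edgeColor (D.arriving x Strand.under) + v.edgeColor (D.departing x Strand.under) =
      2 * v.edgeColor (D.arriving x Strand.over) := by
  have h : 2 * v.edgeColor (D.arriving x Strand.over) - v.edgeColor (D.underRight x) =
    v.edgeColor (D.underLeft x) := v.isColoring x
  by_cases hs : D.sign x = 1
  · simp only [underRight, underLeft, hs, if_true] at h
    linear_combination -h
  · simp only [underRight, underLeft, hs, if_false] at h
    linear_combination -h

theorem edgeColor_departing_over (v : D.ShadowColoring (Quandle.Dihedral p)) (x : D.Crossing) :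
    v.edgeColor (D.departing x Strand.over) = v.edgeColor (D.arriving x Strand.over) :=
  congrArg v.arc (arcOf_departing_over x)

theorem regionColor_left (v : D.ShadowColoring (Quandle.Dihedral p)) (e : D.Edge) :
    v.regionColor (D.left e) = 2 * v.edgeColor e - v.regionColor (D.right e) :=
  (v.act_right e).symm

/-- A shadow coloring by a dihedral quandle from linear equations. -/
def ofLinear (c : D.Arc → ZMod p) (r : D.Region → ZMod p)
    (hc : ∀ x, c (D.arcOf (D.arriving x Strand.under)) + c (D.arcOf (D.departing x Strand.under)) =
      2 * c (D.arcOf (D.arriving x Strand.over)))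
    (hr : ∀ e, r (D.left e) = 2 * c (D.arcOf e) - r (D.right e)) :
    D.ShadowColoring (Quandle.Dihedral p) where
  arc := c
  region := r
  isColoring x := by
    change 2 * c (D.arcOf (D.arriving x Strand.over)) - c (D.arcOf (D.underRight x)) =
      c (D.arcOf (D.underLeft x))
    have h := hc x
    by_cases hs : D.sign x = 1
    · simp only [underRight, underLeft, hs, if_true]
      linear_combination -h
    · simp only [underRight, underLeft, hs, if_false]
      linear_combination -h
  act_right e := (hr e).symm

theorem eq_of_arc_eq {v w : D.ShadowColoring (Quandle.Dihedral p)} (h : v.arc = w.arc)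
    (h' : v.region D.unbounded = w.region D.unbounded) : v = w := by
  refine ShadowColoring.ext h (funext fun r => ?_)
  refine (D.eq_of_invariant (fun r => (v.regionColor r, w.regionColor r))
    (fun z => z.1 = z.2) (fun e => ?_) r).2 h'
  have : v.edgeColor e = w.edgeColor e := congrFun h _
  simp only [regionColor_left, this]
  exact sub_right_inj.symm

/-- The weight of the crossings, without reference to their signs. -/
theorem weight_mochizukiCocycle [Fact p.Prime] (v : D.ShadowColoring (Quandle.Dihedral p)) :
    v.weight (mochizukiCocycle p) =
      ∑ x, (v.regionColor (D.right (D.arriving x Strand.under)) -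
          v.edgeColor (D.arriving x Strand.under)) *
        quotientMod p (frobeniusLift (v.edgeColor (D.arriving x Strand.under)) +
          frobeniusLift (v.edgeColor (D.departing x Strand.under)) -
          2 * frobeniusLift (v.edgeColor (D.arriving x Strand.over))) := by
  refine Finset.sum_congr rfl fun x _ => ?_
  have h := v.edgeColor_add x
  rcases Int.units_eq_one_or (D.sign x) with hs | hs
  · rw [underRight, if_pos hs, hs]
    exact (one_smul ℤ _).trans (mochizukiCocycle_eq h)
  -- At a negative crossing the cocycle reads the departing under edge. Exchanging the under edges
  -- negates the first factor and fixes the quotient, which absorbs the sign.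
  · rw [underRight, if_neg (by simp [hs]), hs]
    refine (congrArg (((-1 : ℤˣ) : ℤ) • ·) (mochizukiCocycle_eq ((add_comm _ _).trans h))).trans ?_
    change ((-1 : ℤˣ) : ℤ) • ((v.regionColor (D.right (D.departing x Strand.under)) -
      v.edgeColor (D.departing x Strand.under)) * _) = _
    rw [(D.right_sub_eq v.edgeColor_add v.edgeColor_departing_over v.regionColor_left x).1]
    rw [add_comm (frobeniusLift _), Units.val_neg, Units.val_one, neg_one_zsmul]
    ring

/-- Change of the region colors by a multiple of a checkerboard coloring. -/
def shift (v : D.ShadowColoring (Quandle.Dihedral p)) {s : D.Region → ℤ}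
    (hs : ∀ e, s (D.left e) = - s (D.right e)) (t : ZMod p) :
    D.ShadowColoring (Quandle.Dihedral p) :=
  ofLinear v.arcColor (fun r => v.regionColor r + t * s r) v.edgeColor_add fun e => by
    have := v.regionColor_left e
    rw [this, hs]
    push_cast
    change _ = 2 * v.edgeColor e - _
    ring

/-- Composition with an affine map. -/
def affine (v : D.ShadowColoring (Quandle.Dihedral p)) (l b : ZMod p) :
    D.ShadowColoring (Quandle.Dihedral p) :=
  ofLinear (fun α => l * v.arcColor α + b) (fun r => l * v.regionColor r + b)
    (fun x => by
      have := v.edgeColor_add x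
      simp only [edgeColor] at this
      linear_combination l * this)
    (fun e => by
      have := v.regionColor_left e
      simp only [edgeColor] at this
      linear_combination l * this)

/-- The sum of two colorings. -/
def add (v w : D.ShadowColoring (Quandle.Dihedral p)) : D.ShadowColoring (Quandle.Dihedral p) :=
  ofLinear (fun α => v.arcColor α + w.arcColor α) (fun r => v.regionColor r + w.regionColor r)
    (fun x => by
      have h := v.edgeColor_add x
      have h' := w.edgeColor_add x
      simp only [edgeColor] at h h'
      linear_combination h + h')
    (fun e => by
      have h := v.regionColor_left e
      have h' := w.regionColor_left e
      simp only [edgeColor] at h h'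
      linear_combination h + h')

variable [Fact p.Prime]

/-- The weight changes by t ∑ s · (q / p). The undivided sum ∑ s · q telescopes to zero in ℤ, and p
divides every q, so the quotients sum to zero as well. -/
theorem weight_shift (v : D.ShadowColoring (Quandle.Dihedral p)) {s : D.Region → ℤ}
    (hs : ∀ e, s (D.left e) = - s (D.right e)) (t : ZMod p) :
    (v.shift hs t).weight (mochizukiCocycle p) = v.weight (mochizukiCocycle p) := by
  let q : D.Crossing → ℤ := fun x => frobeniusLift (v.edgeColor (D.arriving x Strand.under)) +
    frobeniusLift (v.edgeColor (D.departing x Strand.under)) -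
    2 * frobeniusLift (v.edgeColor (D.arriving x Strand.over))
  have hq : ∀ x, (p : ℤ) ∣ q x := fun x => dvd_frobeniusLift_of_add_eq (v.edgeColor_add x)
  have key : ∑ x, (s (D.right (D.arriving x Strand.under)) : ZMod p) * quotientMod p (q x) = 0 := by
    have h := D.sum_right_sub_mul_eq_zero (c := fun _ => (0 : ℤ)) (r := s) (by simp) (by simp)
      (by simpa using hs) (fun e => frobeniusLift (v.edgeColor e))
      (fun x => by rw [v.edgeColor_departing_over])
    simp only [sub_zero] at h
    have h' := quotientMod_sum (p := p) Finset.univ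
      (fun x => s (D.right (D.arriving x Strand.under)) * q x) (fun x _ => (hq x).mul_left _)
    rw [h] at h'
    simp only [quotientMod_mul (hq _)] at h'
    rw [← h']
    simp [quotientMod]
  rw [weight_mochizukiCocycle, weight_mochizukiCocycle]
  change ∑ x, (v.regionColor _ + t * _ - v.edgeColor _) * quotientMod p (q x) =
    ∑ x, (v.regionColor _ - v.edgeColor _) * quotientMod p (q x)
  rw [← sub_eq_zero, ← Finset.sum_sub_distrib, ← mul_zero t, ← key, Finset.mul_sum]
  exact Finset.sum_congr rfl fun x _ => by ring

/-- One factor l comes from x - y and one from the quotient. Translation by b fixes x - y and alters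
the quotients by terms that telescope. -/
theorem weight_affine (v : D.ShadowColoring (Quandle.Dihedral p)) (l b : ZMod p) :
    (v.affine l b).weight (mochizukiCocycle p) = l ^ 2 * v.weight (mochizukiCocycle p) := by
  let w := v.affine l 0
  have hw : ∀ e, w.edgeColor e = l * v.edgeColor e := fun e => add_zero (l * v.edgeColor e)
  have hw' : ∀ r, w.regionColor r = l * v.regionColor r := fun r => add_zero (l * v.regionColor r)
  have hv : ∀ e, (v.affine l b).edgeColor e = w.edgeColor e + b := fun e => by rw [hw]; rfl
  have hv' : ∀ r, (v.affine l b).regionColor r = w.regionColor r + b := fun r => by rw [hw']; rfl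
  have h₁ : (v.affine l b).weight (mochizukiCocycle p) = w.weight (mochizukiCocycle p) := by
    rw [weight_mochizukiCocycle, weight_mochizukiCocycle, ← sub_eq_zero,
      ← D.sum_right_sub_mul_eq_zero w.edgeColor_add w.edgeColor_departing_over w.regionColor_left
        (fun e => translationDefect b (w.edgeColor e))
        (fun x => by rw [w.edgeColor_departing_over]),
      ← Finset.sum_sub_distrib]
    refine Finset.sum_congr rfl fun x _ => ?_
    simp only [hv, hv']
    rw [quotientMod_frobeniusLift_add b (w.edgeColor_add x)]
    ring
  rw [h₁, weight_mochizukiCocycle, weight_mochizukiCocycle, Finset.mul_sum]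
  refine Finset.sum_congr rfl fun x _ => ?_
  simp only [hw, hw']
  rw [quotientMod_frobeniusLift_mul l (v.edgeColor_add x)]
  ring

end ShadowColoring

end OrientedLinkDiagram

namespace OrientedLinkDiagram

/-! ### The space of colorings -/

section ColoringSpace

variable (D : OrientedLinkDiagram) (p : ℕ) [Fact p.Prime]

/-- The colorings of the arcs that extend to shadow colorings. -/
def coloringSpace : Submodule (ZMod p) (D.Arc → ZMod p) where
  carrier := Set.range (ShadowColoring.arcColor (D := D) (p := p))
  add_mem' := by
    rintro _ _ ⟨v, rfl⟩ ⟨w, rfl⟩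
    exact ⟨v.add w, rfl⟩
  zero_mem' := ⟨ShadowColoring.ofLinear 0 0 (by simp) (by simp), rfl⟩
  smul_mem' := by
    rintro l _ ⟨v, rfl⟩
    exact ⟨v.affine l 0, funext fun α => add_zero (l * v.arcColor α)⟩

/-- The constant coloring with value `1`. -/
def constantColoring : D.coloringSpace p :=
  ⟨1, ShadowColoring.ofLinear 1 1 (by simp; norm_num) (by simp; norm_num), rfl⟩

variable {D p}

/-- The arc coloring underlying a shadow coloring. -/
def ShadowColoring.toSpace (v : D.ShadowColoring (Quandle.Dihedral p)) : D.coloringSpace p :=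
  ⟨v.arcColor, v, rfl⟩

theorem exists_shadowColoring (a : ZMod p) (w : D.coloringSpace p) :
    ∃ v : D.ShadowColoring (Quandle.Dihedral p),
      v.regionColor D.unbounded = a ∧ v.toSpace = w := by
  obtain ⟨_, v, rfl⟩ := w
  obtain ⟨s, hs, hs'⟩ := D.exists_checkerboard
  refine ⟨v.shift hs' (a - v.regionColor D.unbounded), ?_, rfl⟩
  change v.regionColor D.unbounded + (a - v.regionColor D.unbounded) * s D.unbounded = a
  rw [hs]
  simp

/-- Shadow colorings with the same arc colors differ by a multiple of the checkerboard coloring. -/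
theorem weight_eq_of_toSpace_eq {v w : D.ShadowColoring (Quandle.Dihedral p)}
    (h : v.toSpace = w.toSpace) :
    v.weight (mochizukiCocycle p) = w.weight (mochizukiCocycle p) := by
  obtain ⟨s, hs, hs'⟩ := D.exists_checkerboard
  have : v.shift hs' (w.regionColor D.unbounded - v.regionColor D.unbounded) = w := by
    refine ShadowColoring.eq_of_arc_eq (Subtype.ext_iff.1 h) ?_
    change v.regionColor D.unbounded +
      (w.regionColor D.unbounded - v.regionColor D.unbounded) * s D.unbounded =
        w.regionColor D.unbounded
    rw [hs]
    simp
  rw [← this, ShadowColoring.weight_shift]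

theorem ShadowColoring.toSpace_affine (v : D.ShadowColoring (Quandle.Dihedral p)) (l b : ZMod p) :
    (v.affine l b).toSpace = l • v.toSpace + b • D.constantColoring p :=
  Subtype.ext (funext fun α => congrArg (l * v.arcColor α + ·) (mul_one b).symm)

/-- The weight of an arc coloring. -/
noncomputable def spaceWeight (w : D.coloringSpace p) : ZMod p :=
  (exists_shadowColoring 0 w).choose.weight (mochizukiCocycle p)

theorem spaceWeight_toSpace (v : D.ShadowColoring (Quandle.Dihedral p)) :
    spaceWeight v.toSpace = v.weight (mochizukiCocycle p) :=
  weight_eq_of_toSpace_eq (exists_shadowColoring 0 v.toSpace).choose_spec.2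

theorem spaceWeight_affine (l b : ZMod p) (w : D.coloringSpace p) :
    spaceWeight (l • w + b • D.constantColoring p) = l ^ 2 * spaceWeight w := by
  obtain ⟨v, -, rfl⟩ := exists_shadowColoring 0 w
  rw [← ShadowColoring.toSpace_affine, spaceWeight_toSpace, spaceWeight_toSpace,
    ShadowColoring.weight_affine]

/-- Arc colorings correspond to shadow colorings with prescribed unbounded color. -/
noncomputable def equivColoringSpace (a : Quandle.Dihedral p) :
    D.ShadowColoringAt (Quandle.Dihedral p) a ≃ D.coloringSpace p :=
  Equiv.ofBijective (fun v => v.1.toSpace)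
    ⟨fun v w h => Subtype.ext
      (ShadowColoring.eq_of_arc_eq (Subtype.ext_iff.1 h) (v.2.trans w.2.symm)), fun w => by
      obtain ⟨v, hv, hw⟩ := exists_shadowColoring a w
      exact ⟨⟨v, hv⟩, hw⟩⟩

theorem spaceWeight_equivColoringSpace {a : Quandle.Dihedral p}
    (v : D.ShadowColoringAt (Quandle.Dihedral p) a) :
    spaceWeight (equivColoringSpace a v) = v.1.weight (mochizukiCocycle p) :=
  spaceWeight_toSpace v.1

/-- The color of the unbounded region is free and does not affect the weight, whence the factor p.
-/
theorem count_shadowCocycleInvariant (k : ZMod p) :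
    (D.shadowCocycleInvariant (mochizukiCocycle p)).count k =
      p * Nat.card {w : D.coloringSpace p // spaceWeight w = k} := by
  classical
  let _ : Fintype (D.ShadowColoring (Quandle.Dihedral p)) := Fintype.ofFinite _
  have h : (D.shadowCocycleInvariant (mochizukiCocycle p)).count k =
      Nat.card {v : D.ShadowColoring (Quandle.Dihedral p) //
        v.weight (mochizukiCocycle p) = k} := by
    rw [shadowCocycleInvariant, Multiset.count_map, Nat.card_eq_fintype_card, Fintype.card_subtype]
    simp only [eq_comm (a := k)]
    rfl
  rw [h]
  refine Eq.trans ?_ ((Nat.card_prod (ZMod p) _).trans (congrArg (· * _) (Nat.card_zmod p)))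
  refine Nat.card_congr (Equiv.ofBijective
    (fun v => (v.1.regionColor D.unbounded, ⟨v.1.toSpace, (spaceWeight_toSpace v.1).trans v.2⟩))
    ⟨fun v w h => ?_, ?_⟩)
  · rw [Prod.mk.injEq, Subtype.mk.injEq] at h
    exact Subtype.ext (ShadowColoring.eq_of_arc_eq (Subtype.ext_iff.1 h.2) h.1)
  · rintro ⟨a, w, rfl⟩
    obtain ⟨v, rfl, rfl⟩ := exists_shadowColoring a w
    exact ⟨⟨v, (spaceWeight_toSpace v).symm⟩, rfl⟩

/-! ### From equal invariants to isomorphic quivers -/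

theorem shadowCocycleInvariant_eq_iff (D' : OrientedLinkDiagram) :
    D.shadowCocycleInvariant (mochizukiCocycle p) = D'.shadowCocycleInvariant (mochizukiCocycle p) ↔
      ∀ k : ZMod p, Nat.card {w : D.coloringSpace p // spaceWeight w = k} =
        Nat.card {w : D'.coloringSpace p // spaceWeight w = k} := by
  classical
  rw [Multiset.ext]
  refine forall_congr' fun k => ?_
  rw [count_shadowCocycleInvariant, count_shadowCocycleInvariant]
  exact Nat.mul_right_inj (Fact.out : p.Prime).ne_zero

theorem constantColoring_ne_zero_iff : D.constantColoring p ≠ 0 ↔ Nonempty D.Arc := by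
  rw [← not_isEmpty_iff, not_iff_not]
  constructor
  · intro h
    exact ⟨fun α => one_ne_zero (α := ZMod p) (congrFun (Subtype.ext_iff.1 h) α)⟩
  · intro h
    exact Subtype.ext (Subsingleton.elim _ _)

theorem exists_affine_equiv_coloringSpace {D' : OrientedLinkDiagram}
    (h : ∀ k : ZMod p, Nat.card {w : D.coloringSpace p // spaceWeight w = k} =
        Nat.card {w : D'.coloringSpace p // spaceWeight w = k}) :
    ∃ φ : D.coloringSpace p ≃ D'.coloringSpace p, (∀ w, spaceWeight w = spaceWeight (φ w)) ∧
      ∀ (l b : ZMod p) w, φ (l • w + b • D.constantColoring p) =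
        l • φ w + b • D'.constantColoring p := by
  let ψ : D.coloringSpace p ≃ D'.coloringSpace p :=
    (Equiv.sigmaFiberEquiv spaceWeight).symm.trans ((Equiv.sigmaCongrRight fun k =>
      (Finite.card_eq.1 (h k)).some).trans (Equiv.sigmaFiberEquiv spaceWeight))
  have hψ : ∀ w, spaceWeight w = spaceWeight (ψ w) := fun w =>
    ((Finite.card_eq.1 (h (spaceWeight w))).some ⟨w, rfl⟩).2.symm
  have aux : ∀ E : OrientedLinkDiagram, ¬ Nonempty E.Arc → Subsingleton (E.coloringSpace p) := by
    intro E hE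
    rw [not_nonempty_iff] at hE
    infer_instance
  -- Without arcs the constant coloring is zero and the matching argument does not apply. Both
  -- spaces are then single points, so the label-preserving bijection ψ suffices.
  by_cases hD : Nonempty D.Arc
  · by_cases hD' : Nonempty D'.Arc
    · exact exists_affine_equiv_of_card_fiber_eq (constantColoring_ne_zero_iff.2 hD)
        (constantColoring_ne_zero_iff.2 hD') spaceWeight_affine spaceWeight_affine h
    · have := aux D' hD'
      exact ⟨ψ, hψ, fun _ _ _ => Subsingleton.elim _ _⟩
  · have := aux D hD
    have := ψ.symm.subsingleton
    exact ⟨ψ, hψ, fun _ _ _ => Subsingleton.elim _ _⟩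

/-- For f = (x ↦ l x + b), both sides become w = l • v + b • e in the coloring spaces, a relation
that φ respects and reflects. -/
theorem arc_eq_comp_iff {a a' : Quandle.Dihedral p} {D' : OrientedLinkDiagram}
    {φ : D.coloringSpace p ≃ D'.coloringSpace p}
    (hφ : ∀ (l b : ZMod p) w, φ (l • w + b • D.constantColoring p) =
        l • φ w + b • D'.constantColoring p)
    (f : Quandle.Dihedral p →◃ Quandle.Dihedral p)
    (v w : D.ShadowColoringAt (Quandle.Dihedral p) a) :
    w.1.arc = f ∘ v.1.arc ↔
      ((equivColoringSpace a').symm (φ (equivColoringSpace a w))).1.arc =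
        f ∘ ((equivColoringSpace a').symm (φ (equivColoringSpace a v))).1.arc := by
  obtain ⟨l, b, hf⟩ := Quandle.Dihedral.exists_affine f
  have key : ∀ {E : OrientedLinkDiagram} {c : Quandle.Dihedral p}
      (v w : E.ShadowColoringAt (Quandle.Dihedral p) c), w.1.arc = f ∘ v.1.arc ↔
        equivColoringSpace c w = l • equivColoringSpace c v + b • E.constantColoring p := by
    intro E c v w
    rw [Subtype.ext_iff]
    have : (f ∘ v.1.arc : E.Arc → ZMod p) =
        ((l • equivColoringSpace c v + b • E.constantColoring p : E.coloringSpace p) :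
          E.Arc → ZMod p) := by
      funext α
      exact (hf _).trans (congrArg (l * v.1.arcColor α + ·) (mul_one b).symm)
    rw [← this]
    rfl
  rw [key, key, Equiv.apply_symm_apply, Equiv.apply_symm_apply, ← hφ, φ.apply_eq_iff_eq]

theorem shadowCocycleInvariant_eq_of_equiv {a : Quandle.Dihedral p} {D' : OrientedLinkDiagram}
    (φ : D.ShadowColoringAt (Quandle.Dihedral p) a ≃ D'.ShadowColoringAt (Quandle.Dihedral p) a)
    (hφ : ∀ v, v.1.weight (mochizukiCocycle p) = (φ v).1.weight (mochizukiCocycle p)) :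
    D.shadowCocycleInvariant (mochizukiCocycle p) =
      D'.shadowCocycleInvariant (mochizukiCocycle p) := by
  rw [shadowCocycleInvariant_eq_iff]
  intro k
  refine Nat.card_congr (((equivColoringSpace a).symm.trans
    (φ.trans (equivColoringSpace a))).subtypeEquiv fun w => ?_)
  obtain ⟨v, rfl⟩ := (equivColoringSpace a).surjective w
  simp only [Equiv.trans_apply, Equiv.symm_apply_apply, spaceWeight_equivColoringSpace]
  rw [hφ]

/-- Diagrams with the same invariant have shadow colorings that match compatibly with weights and
endomorphisms. -/
theorem exists_equiv_of_shadowCocycleInvariant_eq (a : Quandle.Dihedral p)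
    {D' : OrientedLinkDiagram} (h : D.shadowCocycleInvariant (mochizukiCocycle p) =
      D'.shadowCocycleInvariant (mochizukiCocycle p)) :
    ∃ φ : D.ShadowColoringAt (Quandle.Dihedral p) a ≃
        D'.ShadowColoringAt (Quandle.Dihedral p) a,
      (∀ (f : Quandle.Dihedral p →◃ Quandle.Dihedral p) v w,
        w.1.arc = f ∘ v.1.arc ↔ (φ w).1.arc = f ∘ (φ v).1.arc) ∧
      ∀ v, v.1.weight (mochizukiCocycle p) = (φ v).1.weight (mochizukiCocycle p) := by
  obtain ⟨φ, hφ, hφ'⟩ :=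
    exists_affine_equiv_coloringSpace ((shadowCocycleInvariant_eq_iff D').1 h)
  refine ⟨(equivColoringSpace a).trans (φ.trans (equivColoringSpace a).symm),
    arc_eq_comp_iff hφ', fun v => ?_⟩
  rw [← spaceWeight_equivColoringSpace, ← spaceWeight_equivColoringSpace, hφ]
  simp only [Equiv.trans_apply, Equiv.apply_symm_apply]

end ColoringSpace

end OrientedLinkDiagram

theorem mainTheorem2 (p : ℕ) [Fact p.Prime] (hp : Odd p) (D D' : OrientedLinkDiagram)
    (a : Quandle.Dihedral p) (S : Set (Quandle.Dihedral p →◃ Quandle.Dihedral p)) :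
    ((D.shadowCocycleQuiver S (mochizukiCocycle p) a).Isomorphic
        (D'.shadowCocycleQuiver S (mochizukiCocycle p) a) ↔
      D.shadowCocycleInvariant (mochizukiCocycle p) =
        D'.shadowCocycleInvariant (mochizukiCocycle p)) ∧
    ((D.shadowCocycleMultiquiver S (mochizukiCocycle p) a).Isomorphic
        (D'.shadowCocycleMultiquiver S (mochizukiCocycle p) a) ↔
      D.shadowCocycleInvariant (mochizukiCocycle p) =
        D'.shadowCocycleInvariant (mochizukiCocycle p)) := by
  refine ⟨⟨fun ⟨φ, _, hφ⟩ => OrientedLinkDiagram.shadowCocycleInvariant_eq_of_equiv φ hφ,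
    fun h => ?_⟩, ⟨fun ⟨φ, _, hφ⟩ => OrientedLinkDiagram.shadowCocycleInvariant_eq_of_equiv φ hφ,
    fun h => ?_⟩⟩ <;>
  obtain ⟨φ, hφ, hφ'⟩ := OrientedLinkDiagram.exists_equiv_of_shadowCocycleInvariant_eq a h
  · refine ⟨φ, fun v w => ⟨Equiv.ulift.trans (Equiv.plift.trans (Equiv.trans (Equiv.ofIff ?_)
      (Equiv.plift.symm.trans Equiv.ulift.symm)))⟩, hφ'⟩
    exact exists_congr fun f => and_congr_right fun _ => hφ f v w
  · exact ⟨φ, fun v w => ⟨Equiv.subtypeEquivRight fun f => and_congr_right fun _ => hφ f v w⟩, hφ'⟩
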